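/- Let $K$ be an algebraically closed field of characteristic $0$, let $n \ge 0$, and let $V$ be a (Zariski closed, not necessarily irreducible) subvariety of $\mathbb{G}_{m,K}^n$. A torsion point is an element of finite order of $\mathbb{G}_{m,K}^n(K) = (K^\times)^n$, and a torsion coset is an irreducible component of an algebraic (i.e. Zariski closed) subgroup of $\mathbb{G}_{m,K}^n$. Then the Zariski closure of the set of torsion points that lie on $V$ is a finite (possibly empty) union of torsion cosets. -/

import Mathlib

/-- The group `(Kˣ)ⁿ` of `K`-points of the algebraic torus `𝔾ₘⁿ` over `K`. It is a separate type so
that it carries the Zariski topology (below) and no product topology. -/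
def AlgTorus (K : Type*) [Field K] (n : ℕ) : Type _ := Fin n → Kˣ

namespace AlgTorus

variable {K : Type*} [Field K] {n : ℕ}

/-- Coordinatewise multiplication. -/
instance : CommGroup (AlgTorus K n) := inferInstanceAs (CommGroup (Fin n → Kˣ))

/-- The monomial `x₁ ^ u₁ ⋯ xₙ ^ uₙ` with integer exponents, evaluated at the point `x`;
multiplicative in the exponent vector `u`. -/
def monomialAt (x : AlgTorus K n) : Multiplicative (Fin n → ℤ) →* K where
  toFun u := ((∏ i, (x i : Kˣ) ^ (Multiplicative.toAdd u i) : Kˣ) : K)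
  map_one' := by simp
  map_mul' u v := by
    rw [← Units.val_mul, ← Finset.prod_mul_distrib]
    simp only [toAdd_mul, Pi.add_apply, zpow_add]

/-- The ring `K[x₁^{±1}, …, xₙ^{±1}]` of Laurent polynomials: the group algebra of `ℤⁿ`. -/
abbrev LaurentPoly (K : Type*) [Field K] (n : ℕ) : Type _ := AddMonoidAlgebra K (Fin n → ℤ)

/-- Evaluation `∑ c_u x^u` of Laurent polynomials at a point of the torus. -/
noncomputable def evalAt (x : AlgTorus K n) : LaurentPoly K n →ₐ[K] K :=
  AddMonoidAlgebra.lift K K (Fin n → ℤ) (monomialAt x)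

/-- The common zeros in the torus of a set of Laurent polynomials. -/
def zeroLocus (S : Set (LaurentPoly K n)) : Set (AlgTorus K n) :=
  {x | ∀ f ∈ S, evalAt x f = 0}

/-- The Zariski topology: the closed sets are the zero loci of sets of Laurent polynomials. -/
instance zariskiTopology : TopologicalSpace (AlgTorus K n) :=
  TopologicalSpace.ofClosed {Z | ∃ S : Set (LaurentPoly K n), Z = zeroLocus S}
    ⟨{1}, by ext x; simp [zeroLocus]⟩
    (by
      intro A hA
      refine ⟨{f | ∃ S : Set (LaurentPoly K n), zeroLocus S ∈ A ∧ f ∈ S}, ?_⟩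
      ext x
      constructor
      · rintro hx f ⟨S, hS, hf⟩
        exact hx _ hS f hf
      · intro hx Z hZ
        obtain ⟨S, rfl⟩ := hA hZ
        exact fun f hf => hx f ⟨S, hZ, hf⟩)
    (by
      rintro _ ⟨S, rfl⟩ _ ⟨T, rfl⟩
      refine ⟨{h | ∃ f ∈ S, ∃ g ∈ T, h = f * g}, ?_⟩
      ext x
      constructor
      · rintro (hx | hx) _ ⟨f, hf, g, hg, rfl⟩
        · rw [map_mul, hx f hf, zero_mul]
        · rw [map_mul, hx g hg, mul_zero]
      · intro hx
        by_contra hcon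
        simp only [zeroLocus, Set.mem_union, Set.mem_ofPred_eq, not_or, not_forall] at hcon
        obtain ⟨⟨f, hf, hfx⟩, ⟨g, hg, hgx⟩⟩ := hcon
        have h := hx (f * g) ⟨f, hf, g, hg, rfl⟩
        rw [map_mul] at h
        exact (mul_eq_zero.mp h).elim hfx hgx)

theorem isClosed_iff {Z : Set (AlgTorus K n)} :
    IsClosed Z ↔ ∃ S : Set (LaurentPoly K n), Z = zeroLocus S := by
  rw [← isOpen_compl_iff]
  change (∃ S : Set (LaurentPoly K n), Zᶜᶜ = zeroLocus S) ↔ _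
  rw [compl_compl]

/-- A torsion coset: an irreducible component (a maximal irreducible subset) of an algebraic
subgroup, that is, of a Zariski closed subgroup, of the torus. -/
def IsTorsionCoset (T : Set (AlgTorus K n)) : Prop :=
  ∃ G : Subgroup (AlgTorus K n), IsClosed (G : Set (AlgTorus K n)) ∧
    Maximal (fun Z : Set (AlgTorus K n) => IsIrreducible Z ∧ Z ⊆ (G : Set (AlgTorus K n))) T

end AlgTorus

/-!
The torsion points on `V` form a finite union of cosets `zA`, with `z` a torsion point and `A` a
(not necessarily closed) group of torsion points; taking closures then gives the theorem.

The arithmetic input is Mann's theorem (`NoVanishingSubsum.pow_factorial_card_eq`): in a rational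
linear relation between `k` roots of unity in which no proper subsum vanishes, the ratios of the
roots of unity have order dividing `k!`. Splitting a vanishing sum into minimal vanishing subsums,
one concludes that the zeros of a rational linear combination of characters on a torsion group form
a finite union of cosets (`isCosetUnion_rat_sum_eq_zero`). Arbitrary coefficients reduce to this
case (`isCosetUnion_sum_eq_zero`): expand them in a basis of `K` over the field `L` generated by all
roots of unity, in which the characters take their values, and write the coordinates, which lie in
`L`, as rational combinations of roots of unity. The set `V` is cut out by finitely many Laurent
polynomials, each a linear combination of characters.

As for closures, translations are homeomorphisms and inversion is continuous for the Zariski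
topology, so that the closure of `zA` is `zH` with `H` the closure of `A`, a closed subgroup. The
torus is a Noetherian space, and `zH` is thus a finite union of irreducible components. Each is a
component of the closed subgroup `⟨z⟩H`, since the latter is a finite disjoint union of cosets of
`H` (`AlgTorus.closure_smul_subgroup_eq_sUnion`).
-/

/-! ### Rational linear relations between roots of unity -/

section RootsOfUnity

open scoped Nat IntermediateField

variable {K : Type*} [Field K] [CharZero K] {ι : Type*}

/-- Since `ζ` generates a field of degree `φ (pM)` and `ζ ^ p` one of degree `φ M`, the degree of `ζ`
over `ℚ(ζ ^ p)` is at least `φ (pM) / φ M`; for `p` prime this is `p` if `p ∣ M`, and `p - 1`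
otherwise. -/
lemma IsPrimitiveRoot.le_natDegree_minpoly_adjoin_pow {ζ : K} {p M d : ℕ}
    (hζ : IsPrimitiveRoot ζ (p * M)) (hp : 0 < p) (hM : 0 < M) (hd : d * φ M ≤ φ (p * M)) :
    d ≤ (minpoly ℚ⟮ζ ^ p⟯ ζ).natDegree := by
  have hN : 0 < p * M := Nat.mul_pos hp hM
  have hζp : IsPrimitiveRoot (ζ ^ p) M := hζ.pow hN rfl
  have deg {ξ : K} {k : ℕ} (hξ : IsPrimitiveRoot ξ k) (hk : 0 < k) :
      Module.finrank ℚ ℚ⟮ξ⟯ = φ k := by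
    rw [IntermediateField.adjoin.finrank ((hξ.isIntegral hk).tower_top),
      ← Polynomial.cyclotomic_eq_minpoly_rat hξ hk, Polynomial.natDegree_cyclotomic]
  have hint : IsIntegral ℚ⟮ζ ^ p⟯ ζ := (hζ.isIntegral hN).tower_top
  have : FiniteDimensional ℚ ℚ⟮ζ ^ p⟯ :=
    IntermediateField.adjoin.finiteDimensional ((hζp.isIntegral hM).tower_top)
  have : FiniteDimensional ℚ⟮ζ ^ p⟯ ℚ⟮ζ ^ p⟯⟮ζ⟯ := IntermediateField.adjoin.finiteDimensional hint
  have : FiniteDimensional ℚ ℚ⟮ζ ^ p⟯⟮ζ⟯ := FiniteDimensional.trans ℚ ℚ⟮ζ ^ p⟯ _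
  have hle : ℚ⟮ζ⟯ ≤ (ℚ⟮ζ ^ p⟯⟮ζ⟯).restrictScalars ℚ := by
    rw [IntermediateField.adjoin_simple_le_iff, IntermediateField.mem_restrictScalars]
    exact IntermediateField.mem_adjoin_simple_self _ ζ
  have h1 : φ (p * M) ≤ Module.finrank ℚ ℚ⟮ζ ^ p⟯⟮ζ⟯ := by
    rw [← deg hζ hN]
    exact LinearMap.finrank_le_finrank_of_injective
      (f := (IntermediateField.inclusion hle).toLinearMap)
      (IntermediateField.inclusion_injective hle)
  have : Module.Free ℚ⟮ζ ^ p⟯ ℚ⟮ζ ^ p⟯⟮ζ⟯ := Module.Free.of_divisionRing _ _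
  rw [← Module.finrank_mul_finrank ℚ ℚ⟮ζ ^ p⟯ ℚ⟮ζ ^ p⟯⟮ζ⟯, deg hζp hM,
    IntermediateField.adjoin.finrank hint, mul_comm (φ M)] at h1
  exact Nat.le_of_mul_le_mul_right (hd.trans h1) (Nat.totient_pos.2 hM)

/-- If the powers `1, ζ, …, ζ ^ (d - 1)` are independent over `ℚ(ζ ^ p)`, and only exponents with
residue below `d` modulo `p` occur in a rational relation between powers of `ζ`, then the relation
splits into one relation for each residue class of exponents. -/
lemma IsPrimitiveRoot.sum_filter_mod_eq_zero {ζ : K} {p M d : ℕ}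
    (hζ : IsPrimitiveRoot ζ (p * M)) (hp : 0 < p) (hM : 0 < M) (hd : d * φ M ≤ φ (p * M))
    (I : Finset ι) (c : ι → ℚ) (m : ι → ℕ) (hm : ∀ i ∈ I, m i % p < d)
    (h : ∑ i ∈ I, (c i : K) * ζ ^ m i = 0) (e : ℕ) :
    ∑ i ∈ I with m i % p = e, (c i : K) * ζ ^ m i = 0 := by
  have hdeg := hζ.le_natDegree_minpoly_adjoin_pow hp hM hd
  have hpow (k : ℕ) : ζ ^ k = ((IntermediateField.AdjoinSimple.gen ℚ (ζ ^ p) : ℚ⟮ζ ^ p⟯) : K)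
      ^ (k / p) * ζ ^ (k % p) := by
    rw [IntermediateField.AdjoinSimple.coe_gen, ← pow_mul, ← pow_add, Nat.div_add_mod]
  set a : ℕ → ℚ⟮ζ ^ p⟯ := fun e => ∑ i ∈ I with m i % p = e,
    (c i : ℚ⟮ζ ^ p⟯) * IntermediateField.AdjoinSimple.gen ℚ (ζ ^ p) ^ (m i / p) with ha
  have hae (e : ℕ) : ∑ i ∈ I with m i % p = e, (c i : K) * ζ ^ m i = a e • ζ ^ e := by
    rw [ha, Finset.sum_smul]
    refine Finset.sum_congr rfl fun i hi => ?_
    rw [hpow (m i), (Finset.mem_filter.1 hi).2, IntermediateField.smul_def]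
    push_cast
    ring
  rcases lt_or_ge e d with he | he
  · have hsum : ∑ e : Fin (minpoly ℚ⟮ζ ^ p⟯ ζ).natDegree, a e • ζ ^ (e : ℕ) = 0 := by
      rw [Fin.sum_univ_eq_sum_range (fun e => a e • ζ ^ e)]
      simp_rw [← hae]
      rw [← h]
      exact Finset.sum_fiberwise_of_maps_to
        (fun i hi => Finset.mem_range.2 ((hm i hi).trans_le hdeg)) _
    have := Fintype.linearIndependent_iff.1 (linearIndependent_pow (K := ℚ⟮ζ ^ p⟯) ζ) _ hsum
      ⟨e, he.trans_le hdeg⟩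
    rw [hae]
    simp only at this
    rw [this, zero_smul]
  · rw [Finset.filter_false_of_mem (fun i hi h => ?_), Finset.sum_empty]
    exact absurd (hm i hi) (by omega)

/-- A family of terms has no vanishing proper subsum over `I` if no nonempty proper subset of `I`
has sum zero. -/
def NoVanishingSubsum (I : Finset ι) (a : ι → K) : Prop :=
  ∀ J ⊂ I, J.Nonempty → ∑ i ∈ J, a i ≠ 0

/-- In a rational relation without vanishing proper subsums between `pM`-th roots of unity, the
exponents are all congruent modulo the prime `p`, provided that `p² ∣ pM` or that the relation has
fewer than `p` terms. -/
lemma NoVanishingSubsum.mod_eq {ζ : K} {p M : ℕ} (hζ : IsPrimitiveRoot ζ (p * M)) (hp : p.Prime)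
    (hM : 0 < M) {I : Finset ι} (hpI : p ∣ M ∨ I.card < p) {c : ι → ℚ} {m : ι → ℕ}
    (hI : NoVanishingSubsum I fun i => (c i : K) * ζ ^ m i)
    (h : ∑ i ∈ I, (c i : K) * ζ ^ m i = 0) {i j : ι} (hi : i ∈ I) (hj : j ∈ I) :
    m i % p = m j % p := by
  have hζ0 : ζ ≠ 0 := hζ.ne_zero (Nat.mul_pos hp.pos hM).ne'
  -- If `p ∤ M`, only `p - 1` consecutive powers of `ζ` are independent over `ℚ(ζ ^ p)`. Some residue
  -- does not occur among fewer than `p` exponents, and the shift by `s` moves it to `p - 1`.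
  obtain ⟨s, d, hd, hm⟩ : ∃ s d : ℕ, d * φ M ≤ φ (p * M) ∧ ∀ i ∈ I, (m i + s) % p < d := by
    by_cases hpM : p ∣ M
    · exact ⟨0, p, (Nat.totient_mul_of_prime_of_dvd hp hpM).ge, fun i _ => Nat.mod_lt _ hp.pos⟩
    · have hcard : (I.image fun i => m i % p).card < (Finset.range p).card := by
        rw [Finset.card_range]
        exact Finset.card_image_le.trans_lt (hpI.resolve_left hpM)
      obtain ⟨e, he, heI⟩ := Finset.exists_mem_notMem_of_card_lt_card hcard
      have he := Finset.mem_range.1 he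
      refine ⟨p - 1 - e, p - 1, (Nat.totient_mul_of_prime_of_not_dvd hp hpM).ge, fun i hi => ?_⟩
      have hne : m i % p ≠ e := fun h => heI (Finset.mem_image.2 ⟨i, hi, h⟩)
      have hlt := Nat.mod_lt (m i) hp.pos
      rw [Nat.add_mod, Nat.mod_eq_of_lt (show p - 1 - e < p by omega)]
      rcases lt_or_ge (m i % p + (p - 1 - e)) p with h1 | h1
      · rw [Nat.mod_eq_of_lt h1]
        omega
      · rw [Nat.mod_eq_sub_mod h1, Nat.mod_eq_of_lt (by omega)]
        omega
  have key (J : Finset ι) : ∑ i ∈ J, (c i : K) * ζ ^ (m i + s)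
      = (∑ i ∈ J, (c i : K) * ζ ^ m i) * ζ ^ s := by
    rw [Finset.sum_mul]
    exact Finset.sum_congr rfl fun i _ => by ring
  have h0 := hζ.sum_filter_mod_eq_zero hp.pos hM hd I c (fun i => m i + s) hm
    (by rw [key, h, zero_mul]) ((m j + s) % p)
  rw [key] at h0
  have h0 := (mul_eq_zero.1 h0).resolve_right (pow_ne_zero _ hζ0)
  by_contra hij
  refine hI _ ?_ ⟨j, ?_⟩ h0
  · refine Finset.filter_ssubset.2 ⟨i, hi, fun h => hij ?_⟩
    exact Nat.ModEq.add_right_cancel' s h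
  · exact Finset.mem_filter.2 ⟨hj, rfl⟩

/-- **Mann's theorem**: in a rational relation with `k` terms and without vanishing proper subsums
between roots of unity, the ratios of any two of the roots of unity are `k!`-th roots of unity.
Indeed the least common order `N` of the ratios is squarefree and has only prime factors `≤ k`,
because any other prime factor `p` would let all ratios be `N / p`-th roots of unity. -/
theorem NoVanishingSubsum.pow_factorial_card_eq [IsAlgClosed K] {I : Finset ι} {c : ι → ℚ}
    {θ : ι → Kˣ} (hθ : ∀ i ∈ I, IsOfFinOrder (θ i))
    (hI : NoVanishingSubsum I fun i => (c i : K) * θ i)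
    (h : ∑ i ∈ I, (c i : K) * θ i = 0) {i j : ι} (hi : i ∈ I) (hj : j ∈ I) :
    θ i ^ (I.card)! = θ j ^ (I.card)! := by
  classical
  have hex : ∃ N, 0 < N ∧ ∀ i ∈ I, θ i ^ N = θ j ^ N := by
    refine ⟨∏ i ∈ I, orderOf (θ i), Finset.prod_pos fun i hi => (hθ i hi).orderOf_pos,
      fun i hi => ?_⟩
    rw [orderOf_dvd_iff_pow_eq_one.1 (Finset.dvd_prod_of_mem (fun i => orderOf (θ i)) hi),
      orderOf_dvd_iff_pow_eq_one.1 (Finset.dvd_prod_of_mem (fun i => orderOf (θ i)) hj)]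
  obtain ⟨hN, hNeq⟩ := Nat.find_spec hex
  have hmin := fun m => Nat.find_min hex (m := m)
  set N := Nat.find hex
  have : NeZero N := ⟨hN.ne'⟩
  have : NeZero (N : K) := ⟨Nat.cast_ne_zero.2 hN.ne'⟩
  obtain ⟨ζ, hζ⟩ := HasEnoughRootsOfUnity.exists_primitiveRoot K N
  have hm : ∀ i, ∃ m : ℕ, i ∈ I → (θ i : K) = θ j * ζ ^ m := fun i => by
    by_cases hi : i ∈ I
    · obtain ⟨m, -, hm⟩ := hζ.eq_pow_of_pow_eq_one (ξ := ((θ i / θ j : Kˣ) : K)) (by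
        rw [← Units.val_pow_eq_pow_val, div_pow, hNeq i hi, div_self', Units.val_one])
      refine ⟨m, fun _ => ?_⟩
      rw [hm, ← Units.val_mul, mul_div_cancel]
    · exact ⟨0, fun h => absurd h hi⟩
  choose m hm using hm
  have key (J : Finset ι) (hJ : J ⊆ I) : ∑ i ∈ J, (c i : K) * θ i
      = θ j * ∑ i ∈ J, (c i : K) * ζ ^ m i := by
    rw [Finset.mul_sum]
    exact Finset.sum_congr rfl fun i hi => by rw [hm i (hJ hi)]; ring
  have hI' : NoVanishingSubsum I fun i => (c i : K) * ζ ^ m i := fun J hJ hne h0 =>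
    hI J hJ hne (by simp only; rw [key J hJ.subset, h0, mul_zero])
  have h' : ∑ i ∈ I, (c i : K) * ζ ^ m i = 0 := by
    rw [key I subset_rfl] at h
    exact (mul_eq_zero.1 h).resolve_left (θ j).ne_zero
  have hbad {p M : ℕ} (hp : p.Prime) (hNp : N = p * M) : ¬ (p ∣ M ∨ I.card < p) := fun hpI => by
    have hM : 0 < M := Nat.pos_of_ne_zero fun h => hN.ne' (by rw [hNp, h, mul_zero])
    refine hmin M (by rw [hNp]; exact lt_mul_of_one_lt_left hM hp.one_lt) ⟨hM, fun i hi => ?_⟩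
    have hζM (k : ℕ) : (ζ ^ k) ^ M = (ζ ^ (k % p)) ^ M := by
      conv_lhs => rw [← Nat.div_add_mod k p]
      rw [pow_add, mul_pow, ← pow_mul, show p * (k / p) * M = N * (k / p) by rw [hNp]; ring,
        pow_mul, hζ.pow_eq_one, one_pow, one_mul]
    have hθM (k : ι) (hk : k ∈ I) : (θ k : K) ^ M = θ j ^ M * (ζ ^ (m j % p)) ^ M := by
      rw [hm k hk, mul_pow, hζM, hI'.mod_eq (hNp ▸ hζ) hp hM hpI h' hk hj]
    ext
    push_cast
    exact (hθM i hi).trans (hθM j hj).symm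
  have hsq : Squarefree N := Nat.squarefree_iff_prime_squarefree.2 fun p hp ⟨M, hM⟩ =>
    hbad hp (by rw [hM, mul_assoc]) (Or.inl ⟨M, rfl⟩)
  have hdvd : N ∣ (I.card)! := by
    rw [← Nat.prod_primeFactors_of_squarefree hsq]
    refine Finset.prod_primes_dvd _ (fun p hp => (Nat.prime_of_mem_primeFactors hp).prime)
      fun p hp => ?_
    have hp' := Nat.prime_of_mem_primeFactors hp
    obtain ⟨M, hM⟩ := Nat.dvd_of_mem_primeFactors hp
    exact hp'.dvd_factorial.2 (not_lt.1 fun hlt => hbad hp' hM (Or.inr hlt))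
  obtain ⟨k, hk⟩ := hdvd
  rw [hk, pow_mul, pow_mul, hNeq i hi]

end RootsOfUnity

/-! ### Finite unions of cosets in a commutative group -/

section CosetUnions

open scoped Pointwise

variable {G : Type*} [CommGroup G]

/-- A finite (possibly empty) union of cosets of subgroups. The subgroups may differ from one coset
to the next. -/
def IsCosetUnion (S : Set G) : Prop :=
  ∃ F : Set (G × Subgroup G), F.Finite ∧ S = ⋃ p ∈ F, p.1 • (p.2 : Set G)

namespace IsCosetUnion

/-- `S` is empty or a coset of `H` as soon as it is, with each of its points `a`, the coset `aH`. -/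
lemma of_mem_iff {S : Set G} (H : Subgroup G) (h : ∀ a ∈ S, ∀ b, b ∈ S ↔ a⁻¹ * b ∈ H) :
    IsCosetUnion S := by
  rcases S.eq_empty_or_nonempty with rfl | ⟨a, ha⟩
  · exact ⟨∅, Set.finite_empty, by simp⟩
  · refine ⟨{(a, H)}, Set.finite_singleton _, ?_⟩
    ext b
    simp [h a ha b, Set.mem_smul_set_iff_inv_smul_mem]

lemma univ : IsCosetUnion (Set.univ : Set G) := of_mem_iff ⊤ (by simp)

lemma iUnion {α : Type*} [Finite α] {S : α → Set G} (h : ∀ a, IsCosetUnion (S a)) :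
    IsCosetUnion (⋃ a, S a) := by
  choose F hF hS using h
  refine ⟨⋃ a, F a, Set.finite_iUnion hF, ?_⟩
  simp_rw [Set.biUnion_iUnion, ← hS]

lemma union {S T : Set G} (hS : IsCosetUnion S) (hT : IsCosetUnion T) : IsCosetUnion (S ∪ T) := by
  rw [Set.union_eq_iUnion]
  exact iUnion fun b => by cases b <;> assumption

lemma inter {S T : Set G} (hS : IsCosetUnion S) (hT : IsCosetUnion T) : IsCosetUnion (S ∩ T) := by
  obtain ⟨F, hF, rfl⟩ := hS
  obtain ⟨F', hF', rfl⟩ := hT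
  have := hF.to_subtype
  have := hF'.to_subtype
  have : ((⋃ p ∈ F, p.1 • (p.2 : Set G)) ∩ ⋃ p ∈ F', p.1 • (p.2 : Set G))
      = ⋃ q : F × F', (q.1.1.1 • (q.1.1.2 : Set G)) ∩ (q.2.1.1 • (q.2.1.2 : Set G)) := by
    ext g
    simp only [Set.mem_inter_iff, Set.mem_iUnion, Prod.exists, Subtype.exists]
    aesop
  rw [this]
  refine iUnion fun ⟨⟨⟨a, H⟩, _⟩, ⟨⟨b, H'⟩, _⟩⟩ => of_mem_iff (H ⊓ H') fun x hx y => ?_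
  simp only [Set.mem_inter_iff, Set.mem_smul_set_iff_inv_smul_mem, smul_eq_mul, SetLike.mem_coe,
    Subgroup.mem_inf] at hx ⊢
  refine and_congr ?_ ?_
  · rw [← Subgroup.mul_mem_cancel_left H (H.inv_mem hx.1)]
    simp [mul_assoc]
  · rw [← Subgroup.mul_mem_cancel_left H' (H'.inv_mem hx.2)]
    simp [mul_assoc]

lemma biInter {α : Type*} (s : Finset α) {S : α → Set G} (h : ∀ a ∈ s, IsCosetUnion (S a)) :
    IsCosetUnion (⋂ a ∈ s, S a) := by
  classical
  induction s using Finset.induction_on with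
  | empty => simpa using univ
  | insert a s _ ih =>
    rw [Finset.set_biInter_insert]
    exact (h a (Finset.mem_insert_self a s)).inter
      (ih fun b hb => h b (Finset.mem_insert_of_mem hb))

end IsCosetUnion

end CosetUnions

/-! ### Zeros of rational character sums on a torsion group -/

section CharacterSums

open scoped Nat

variable {K : Type*} [Field K] [CharZero K] [IsAlgClosed K] {Γ : Type*} [CommGroup Γ] {ι : Type*}

/-- The zeros of a rational linear combination of characters of a torsion group, twisted by roots of
unity, form a finite union of cosets. At a zero, either a proper subsum vanishes, so that the sum
splits into two shorter vanishing sums, or the ratios of the terms lie in a fixed finite group; and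
prescribed ratios of characters cut out a coset or nothing. -/
theorem isCosetUnion_rat_sum_eq_zero (hΓ : IsMulTorsion Γ) (I : Finset ι) (c : ι → ℚ)
    {η : ι → Kˣ} (hη : ∀ i, IsOfFinOrder (η i)) (χ : ι → Γ →* Kˣ) :
    IsCosetUnion {g | ∑ i ∈ I, (c i : K) * (η i * χ i g : Kˣ) = 0} := by
  classical
  induction I using Finset.strongInduction with
  | H I ih =>
  rcases I.eq_empty_or_nonempty with rfl | ⟨k, hk⟩
  · simpa using IsCosetUnion.univ
  have hfin (i : ι) (g : Γ) : IsOfFinOrder (η i * χ i g) :=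
    (hη i).mul ((χ i).isOfFinOrder (hΓ g))
  -- The points at which the root of unity in the `i`-th term is `ρ i` times that in the `k`-th, for
  -- a choice `ρ` of ratios that makes the sum vanish.
  let D (ρ : I → rootsOfUnity (I.card)! K) : Set Γ :=
    {g | ∑ i : I, (c i : K) * (ρ i : Kˣ) = 0 ∧ ∀ i : I, η i * χ i g = ρ i * (η k * χ k g)}
  have hD (ρ) : IsCosetUnion (D ρ) := by
    refine .of_mem_iff (⨅ i ∈ I, (χ i).eqLocus (χ k)) fun a ha b => ?_
    simp only [Subgroup.mem_iInf, D, Set.mem_ofPred_eq, ha.1, true_and, Subtype.forall]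
    refine forall₂_congr fun i hi => ?_
    have hl : η i * χ i b = (η i * χ i a) * χ i (a⁻¹ * b) := by simp [mul_assoc]
    have hr : (ρ ⟨i, hi⟩ : Kˣ) * (η k * χ k b)
        = ρ ⟨i, hi⟩ * (η k * χ k a) * χ k (a⁻¹ * b) := by simp [mul_assoc]
    rw [hl, hr, ha.2 ⟨i, hi⟩, mul_right_inj]
    rfl
  let 𝒥 : Finset (Finset ι) := {J ∈ I.ssubsets | J.Nonempty}
  have hS : {g | ∑ i ∈ I, (c i : K) * (η i * χ i g : Kˣ) = 0}
      = (⋃ J : 𝒥,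
          {g | ∑ i ∈ J.1, (c i : K) * (η i * χ i g : Kˣ) = 0} ∩
          {g | ∑ i ∈ I \ J.1, (c i : K) * (η i * χ i g : Kˣ) = 0}) ∪ ⋃ ρ, D ρ := by
    ext g
    simp only [Set.mem_union, Set.mem_iUnion, Set.mem_inter_iff, Set.mem_ofPred_eq]
    constructor
    · intro h
      by_cases hI : NoVanishingSubsum I fun i => (c i : K) * (η i * χ i g : Kˣ)
      · right
        have hpow (i : ι) (hi : i ∈ I) := hI.pow_factorial_card_eq (fun i _ => hfin i g) h hi hk
        refine ⟨fun i => ⟨(η i * χ i g) / (η k * χ k g), ?_⟩, ?_, fun i => ?_⟩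
        · rw [mem_rootsOfUnity, div_pow, hpow i i.2, div_self']
        · rw [Finset.sum_coe_sort I
            (fun i => (c i : K) * ((η i * χ i g / (η k * χ k g) : Kˣ) : K))]
          simp_rw [Units.val_div_eq_div_val, ← mul_div_assoc, ← Finset.sum_div, h, zero_div]
        · simp
      · left
        simp only [NoVanishingSubsum, not_forall, not_not] at hI
        obtain ⟨J, hJ, hne, h0⟩ := hI
        refine ⟨⟨J, Finset.mem_filter.2 ⟨Finset.mem_ssubsets.2 hJ, hne⟩⟩, h0, ?_⟩
        rw [← Finset.sum_sdiff hJ.subset] at h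
        rwa [h0, add_zero] at h
    · rintro (⟨⟨J, hJ⟩, h0, h1⟩ | ⟨ρ, h0, h1⟩)
      · rw [← Finset.sum_sdiff (Finset.mem_ssubsets.1 (Finset.mem_filter.1 hJ).1).subset, h0, h1,
          add_zero]
      · rw [← Finset.sum_coe_sort]
        simp_rw [h1, Units.val_mul, ← mul_assoc, ← Finset.sum_mul]
        rw [h0, zero_mul, zero_mul]
  rw [hS]
  have : NeZero (I.card)! := ⟨Nat.factorial_ne_zero _⟩
  refine (IsCosetUnion.iUnion fun ⟨J, hJ⟩ => ?_).union (IsCosetUnion.iUnion hD)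
  obtain ⟨hJI, j, hj⟩ := Finset.mem_filter.1 hJ
  have hJI := Finset.mem_ssubsets.1 hJI
  exact (ih J hJI).inter (ih (I \ J) (Finset.sdiff_ssubset hJI.subset ⟨j, hj⟩))

end CharacterSums

/-! ### Zeros of character sums with arbitrary coefficients -/

section CyclotomicSubfield

variable (K : Type*) [Field K] [CharZero K]

/-- The maximal cyclotomic subfield of `K`: the field generated over `ℚ` by all roots of unity. -/
def cyclotomicSubfield : IntermediateField ℚ K :=
  IntermediateField.adjoin ℚ (Set.range fun ζ : CommGroup.torsion Kˣ => ((ζ : Kˣ) : K))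

variable {K}

lemma coe_mem_cyclotomicSubfield (ζ : CommGroup.torsion Kˣ) :
    ((ζ : Kˣ) : K) ∈ cyclotomicSubfield K :=
  IntermediateField.subset_adjoin _ _ ⟨ζ, rfl⟩

/-- The roots of unity are algebraic and closed under multiplication, so that their `ℚ`-span is
already a field. -/
lemma mem_span_of_mem_cyclotomicSubfield {x : K} (hx : x ∈ cyclotomicSubfield K) :
    x ∈ Submodule.span ℚ (Set.range fun ζ : CommGroup.torsion Kˣ => ((ζ : Kˣ) : K)) := by
  have hrange : (Set.range fun ζ : CommGroup.torsion Kˣ => ((ζ : Kˣ) : K))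
      = (MonoidHom.mrange ((Units.coeHom K).comp (CommGroup.torsion Kˣ).subtype) : Set K) := rfl
  rw [cyclotomicSubfield, ← IntermediateField.mem_toSubalgebra,
    IntermediateField.adjoin_toSubalgebra_of_isAlgebraic, ← Subalgebra.mem_toSubmodule,
    Algebra.adjoin_eq_span, hrange, Submonoid.closure_eq] at hx
  · exact hx
  · rintro _ ⟨ζ, rfl⟩
    obtain ⟨n, hn, h⟩ := isOfFinOrder_iff_pow_eq_one.1 ζ.2
    refine ⟨Polynomial.X ^ n - 1, Polynomial.X_pow_sub_C_ne_zero hn 1, ?_⟩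
    simp [← Units.val_pow_eq_pow_val, h]

variable [IsAlgClosed K] {Γ : Type*} [CommGroup Γ] {ι : Type*}

/-- Coefficients in the cyclotomic subfield are rational combinations of roots of unity, which turns
the sum into a rational combination of characters twisted by roots of unity. -/
lemma isCosetUnion_cyclotomic_sum_eq_zero (hΓ : IsMulTorsion Γ) (I : Finset ι) {c : ι → K}
    (hc : ∀ i, c i ∈ cyclotomicSubfield K) (χ : ι → Γ →* Kˣ) :
    IsCosetUnion {g | ∑ i ∈ I, c i * χ i g = 0} := by
  classical
  have h (i : ι) := (Finsupp.mem_span_range_iff_exists_finsupp).1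
    (mem_span_of_mem_cyclotomicSubfield (hc i))
  choose f hf using h
  convert isCosetUnion_rat_sum_eq_zero (K := K) hΓ (I.sigma fun i => (f i).support)
    (fun p => f p.1 p.2) (η := fun p => p.2) (fun p => p.2.2) (fun p => χ p.1) using 4 with g
  rw [Finset.sum_sigma]
  refine Finset.sum_congr rfl fun i _ => ?_
  rw [← hf i, Finsupp.sum, Finset.sum_mul]
  refine Finset.sum_congr rfl fun ζ _ => ?_
  rw [Algebra.smul_def, Units.val_mul, mul_assoc]
  rfl

/-- The zeros of a linear combination of characters of a torsion group form a finite union of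
cosets. The characters have values in the cyclotomic subfield, so that the sum vanishes if and only
if all its coordinates with respect to a basis of `K` over that field do. -/
theorem isCosetUnion_sum_eq_zero (hΓ : IsMulTorsion Γ) (I : Finset ι) (c : ι → K)
    (χ : ι → Γ →* Kˣ) : IsCosetUnion {g | ∑ i ∈ I, c i * χ i g = 0} := by
  classical
  let b := Module.Basis.ofVectorSpace (cyclotomicSubfield K) K
  have h (g : Γ) : ∑ i ∈ I, c i * χ i g = 0 ↔ ∀ j ∈ I.biUnion fun i => (b.repr (c i)).support,
      ∑ i ∈ I, (b.repr (c i) j : K) * χ i g = 0 := by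
    have hx (i : ι) : c i * χ i g = (⟨χ i g, coe_mem_cyclotomicSubfield
        ⟨χ i g, (χ i).isOfFinOrder (hΓ g)⟩⟩ : cyclotomicSubfield K) • c i := by
      rw [IntermediateField.smul_def, smul_eq_mul, mul_comm]
    have hsum (j) : (b.repr (∑ i ∈ I, c i * χ i g) j : K)
        = ∑ i ∈ I, (b.repr (c i) j : K) * χ i g := by
      simp_rw [hx]
      simp [mul_comm]
    constructor
    · intro h j _
      rw [← hsum, h]
      simp
    · intro h
      rw [← b.repr.map_eq_zero_iff]
      ext j
      rw [hsum]
      by_cases hj : j ∈ I.biUnion fun i => (b.repr (c i)).support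
      · simpa using h j hj
      · simp only [Finset.mem_biUnion, Finsupp.mem_support_iff, not_exists, not_and, not_not] at hj
        simpa using Finset.sum_eq_zero fun i hi => by simp [hj i hi]
  have hS : {g | ∑ i ∈ I, c i * χ i g = 0} = ⋂ j ∈ I.biUnion fun i => (b.repr (c i)).support,
      {g | ∑ i ∈ I, (b.repr (c i) j : K) * χ i g = 0} := by
    ext g
    simp only [Set.mem_iInter, Set.mem_ofPred_eq]
    exact h g
  rw [hS]
  exact IsCosetUnion.biInter _ fun j _ =>
    isCosetUnion_cyclotomic_sum_eq_zero hΓ I (fun i => (b.repr (c i) j).2) χ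

end CyclotomicSubfield

/-! ### Irreducible components in Noetherian spaces -/

section IrreducibleComponents

open TopologicalSpace

variable {X : Type*} [TopologicalSpace X]

/-- A closed subset of a Noetherian space is the union of finitely many of its irreducible
components. -/
theorem exists_finite_maximal_irreducible_sUnion_eq [NoetherianSpace X] {Z : Set X}
    (hZ : IsClosed Z) : ∃ 𝒯 : Set (Set X), 𝒯.Finite ∧
      (∀ T ∈ 𝒯, Maximal (fun Y : Set X => IsIrreducible Y ∧ Y ⊆ Z) T) ∧ Z = ⋃₀ 𝒯 := by
  obtain ⟨S, hSf, hSc, hSi, rfl⟩ := NoetherianSpace.exists_finite_set_isClosed_irreducible hZ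
  refine ⟨{T | Maximal (· ∈ S) T}, hSf.subset fun T hT => hT.prop, fun T hT => ?_, ?_⟩
  · refine ⟨⟨hSi T hT.prop, Set.subset_sUnion_of_mem hT.prop⟩, fun Y ⟨hY, hYS⟩ hTY => ?_⟩
    obtain ⟨W, hW, hYW⟩ := isIrreducible_iff_sUnion_isClosed.1 hY hSf.toFinset
      (fun z hz => hSc z (hSf.mem_toFinset.1 hz)) (by simpa using hYS)
    exact hYW.trans (hT.le_of_ge (hSf.mem_toFinset.1 hW) (hTY.trans hYW))
  · refine Set.Subset.antisymm (Set.sUnion_subset fun s hs => ?_)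
      (Set.sUnion_subset_sUnion fun T hT => hT.prop)
    obtain ⟨T, hsT, hT⟩ := hSf.exists_le_maximal hs
    exact Set.subset_sUnion_of_subset _ T hsT hT

end IrreducibleComponents

/-! ### The Zariski topology of the torus -/

namespace AlgTorus

section Topology

open Pointwise

variable {K : Type*} [Field K] {n : ℕ}

/-- The character `x ↦ x₁ ^ u₁ ⋯ xₙ ^ uₙ` of the torus. -/
def character (u : Fin n → ℤ) : AlgTorus K n →* Kˣ where
  toFun x := ∏ i, (x i : Kˣ) ^ u i
  map_one' := Finset.prod_eq_one fun i _ => one_zpow _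
  map_mul' x y := by
    rw [← Finset.prod_mul_distrib]
    exact Finset.prod_congr rfl fun i _ => mul_zpow _ _ _

lemma character_neg (u : Fin n → ℤ) (x : AlgTorus K n) : character (-u) x = character u x⁻¹ := by
  rw [map_inv]
  simp [character]

lemma evalAt_eq_sum (x : AlgTorus K n) (f : LaurentPoly K n) :
    evalAt x f = ∑ u ∈ f.coeff.support, f.coeff u * character u x := by
  rw [evalAt, AddMonoidAlgebra.lift_apply]
  rfl

lemma evalAt_single (x : AlgTorus K n) (u : Fin n → ℤ) (a : K) :
    evalAt x (AddMonoidAlgebra.single u a) = a * character u x := by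
  rw [evalAt, AddMonoidAlgebra.lift_single]
  rfl

/-- A self-map of the torus that pulls Laurent polynomials back to Laurent polynomials is
continuous. -/
lemma continuous_of_exists_evalAt_eq {φ : AlgTorus K n → AlgTorus K n}
    (h : ∀ f : LaurentPoly K n, ∃ g : LaurentPoly K n, ∀ x, evalAt (φ x) f = evalAt x g) :
    Continuous φ := by
  refine continuous_iff_isClosed.2 fun Z hZ => ?_
  obtain ⟨S, rfl⟩ := isClosed_iff.1 hZ
  choose g hg using h
  refine isClosed_iff.2 ⟨g '' S, ?_⟩
  ext x
  simp [zeroLocus, hg]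

instance : ContinuousConstSMul (AlgTorus K n) (AlgTorus K n) where
  continuous_const_smul a := continuous_of_exists_evalAt_eq fun f =>
    ⟨∑ u ∈ f.coeff.support, .single u (f.coeff u * character u a), fun x => by
      simp [smul_eq_mul, evalAt_eq_sum (a * x), evalAt_single, mul_assoc]⟩

instance : ContinuousInv (AlgTorus K n) where
  continuous_inv := continuous_of_exists_evalAt_eq fun f =>
    ⟨∑ u ∈ f.coeff.support, .single (-u) (f.coeff u), fun x => by
      simp only [map_sum, evalAt_eq_sum x⁻¹, evalAt_single, character_neg]⟩

lemma zeroLocus_span (S : Set (LaurentPoly K n)) :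
    zeroLocus (Ideal.span S : Set (LaurentPoly K n)) = zeroLocus S := by
  ext x
  exact Ideal.span_le (I := RingHom.ker (evalAt x))

/-- The ideal of all Laurent polynomials that vanish on `Z`. -/
noncomputable def vanishingIdeal (Z : Set (AlgTorus K n)) : Ideal (LaurentPoly K n) :=
  ⨅ x ∈ Z, RingHom.ker (evalAt x)

lemma mem_vanishingIdeal {Z : Set (AlgTorus K n)} {f : LaurentPoly K n} :
    f ∈ vanishingIdeal Z ↔ ∀ x ∈ Z, evalAt x f = 0 := by
  simp [vanishingIdeal, Submodule.mem_iInf]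

lemma zeroLocus_vanishingIdeal {Z : Set (AlgTorus K n)} (hZ : IsClosed Z) :
    zeroLocus (vanishingIdeal Z : Set (LaurentPoly K n)) = Z := by
  obtain ⟨S, rfl⟩ := isClosed_iff.1 hZ
  refine Set.Subset.antisymm (fun x hx f hf => hx f ?_) fun x hx f hf => ?_
  · exact mem_vanishingIdeal.2 fun y hy => hy f hf
  · exact mem_vanishingIdeal.1 hf x hx

instance : IsNoetherianRing (LaurentPoly K n) :=
  have : AddMonoid.FG (Fin n → ℤ) := 
    AddGroup.fg_iff_addMonoid_fg.1 (Module.Finite.iff_addGroup_fg.1 inferInstance)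
  Algebra.FiniteType.isNoetherianRing K _

instance : TopologicalSpace.NoetherianSpace (AlgTorus K n) := by
  refine ((TopologicalSpace.noetherianSpace_TFAE _).out 0 1).2 ?_
  have hanti : StrictAnti fun Z : TopologicalSpace.Closeds (AlgTorus K n) =>
      vanishingIdeal (Z : Set (AlgTorus K n)) := by
    refine Antitone.strictAnti_of_injective (fun Z W h f hf => ?_) fun Z W h => ?_
    · exact mem_vanishingIdeal.2 fun x hx => mem_vanishingIdeal.1 hf x (h hx)
    · ext1
      rw [← zeroLocus_vanishingIdeal Z.isClosed, ← zeroLocus_vanishingIdeal W.isClosed]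
      exact congrArg _ (congrArg _ h)
  exact hanti.wellFoundedLT

/-- The Zariski closure of a subgroup of the torus, as a subgroup. The torus is not a topological
group for the Zariski topology, but the continuity of translations and of inversion suffices. -/
def closureSubgroup (A : Subgroup (AlgTorus K n)) : Subgroup (AlgTorus K n) where
  carrier := closure A
  one_mem' := subset_closure A.one_mem
  inv_mem' {a} ha := by
    have : closure (A : Set (AlgTorus K n)) ⊆ (·⁻¹) ⁻¹' closure A :=
      closure_minimal (fun a ha => subset_closure (A.inv_mem ha))
        (isClosed_closure.preimage continuous_inv)
    exact this ha
  mul_mem' {a b} ha hb := by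
    have h1 (a : AlgTorus K n) (ha : a ∈ A) :
        closure (A : Set (AlgTorus K n)) ⊆ (a • ·) ⁻¹' closure A :=
      closure_minimal (fun b hb => subset_closure (A.mul_mem ha hb))
        (isClosed_closure.preimage (continuous_const_smul a))
    have h2 : closure (A : Set (AlgTorus K n)) ⊆ (b • ·) ⁻¹' closure A :=
      closure_minimal (fun a ha => by simpa [mul_comm] using h1 a ha hb)
        (isClosed_closure.preimage (continuous_const_smul b))
    simpa [mul_comm] using h2 ha

/-- The irreducible components of a translate `zH` of a closed subgroup by a torsion point are torsion
cosets: they are components of the subgroup `⟨z⟩H`, a finite union of closed cosets of `H`, which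
are pairwise equal or disjoint. -/
lemma isTorsionCoset_of_maximal {H : Subgroup (AlgTorus K n)}
    (hH : IsClosed (H : Set (AlgTorus K n))) {z : AlgTorus K n} (hz : IsOfFinOrder z)
    {T : Set (AlgTorus K n)}
    (hT : Maximal (fun Y : Set (AlgTorus K n) =>
      IsIrreducible Y ∧ Y ⊆ z • (H : Set (AlgTorus K n))) T) : IsTorsionCoset T := by
  classical
  have hfin : (Subgroup.zpowers z : Set (AlgTorus K n)).Finite := finite_zpowers.2 hz
  have hcoset (a : AlgTorus K n) : IsClosed (a • (H : Set (AlgTorus K n))) := hH.smul a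
  have hG : ((Subgroup.zpowers z ⊔ H : Subgroup (AlgTorus K n)) : Set (AlgTorus K n))
      = ⋃ a ∈ (Subgroup.zpowers z : Set (AlgTorus K n)), a • (H : Set (AlgTorus K n)) := by
    rw [Subgroup.mul_normal]
    exact (Set.iUnion_smul_set _ _).symm
  refine ⟨Subgroup.zpowers z ⊔ H, ?_, ⟨hT.prop.1, hT.prop.2.trans ?_⟩, fun Y ⟨hY, hYG⟩ hTY => ?_⟩
  · rw [hG]
    exact hfin.isClosed_biUnion fun a _ => hcoset a
  · rw [hG]
    exact Set.subset_biUnion_of_mem (u := fun a => a • (H : Set (AlgTorus K n)))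
      (Subgroup.mem_zpowers z)
  · rw [hG] at hYG
    obtain ⟨W, hW, hYW⟩ := isIrreducible_iff_sUnion_isClosed.1 hY
      (hfin.toFinset.image fun a => a • (H : Set (AlgTorus K n)))
      (fun W hW => by
        obtain ⟨a, -, rfl⟩ := Finset.mem_image.1 hW
        exact hcoset a)
      (by simpa using hYG)
    obtain ⟨a, -, rfl⟩ := Finset.mem_image.1 hW
    obtain ⟨t, ht⟩ := hT.prop.1.nonempty
    have hta := hYW (hTY ht)
    have htz := hT.prop.2 ht
    have : a • (H : Set (AlgTorus K n)) = z • (H : Set (AlgTorus K n)) := by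
      rw [Set.mem_smul_set_iff_inv_smul_mem] at hta htz
      rw [leftCoset_eq_iff]
      simpa using H.mul_mem hta (H.inv_mem htz)
    exact hT.le_of_ge ⟨hY, this ▸ hYW⟩ hTY

/-- The Zariski closure of `zA`, with `z` a torsion point and `A` any subgroup, is the translate by `z`
of the closed subgroup `closure A`, hence a finite union of torsion cosets. -/
theorem closure_smul_subgroup_eq_sUnion (A : Subgroup (AlgTorus K n)) {z : AlgTorus K n}
    (hz : IsOfFinOrder z) :
    ∃ 𝒯 : Set (Set (AlgTorus K n)), 𝒯.Finite ∧ (∀ T ∈ 𝒯, IsTorsionCoset T) ∧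
      closure (z • (A : Set (AlgTorus K n))) = ⋃₀ 𝒯 := by
  obtain ⟨𝒯, hfin, hmax, h⟩ := exists_finite_maximal_irreducible_sUnion_eq
    (isClosed_closure (s := z • (A : Set (AlgTorus K n))))
  rw [closure_smul] at hmax
  exact ⟨𝒯, hfin, fun T hT => isTorsionCoset_of_maximal (H := closureSubgroup A)
    isClosed_closure hz (hmax T hT), h⟩

end Topology

/-! ### Torsion points on a closed subset -/

/-- The torsion points of a closed subset form a finite union of cosets of subgroups of the torsion
group of the torus. -/
theorem isCosetUnion_torsion_mem {K : Type*} [Field K] [IsAlgClosed K] [CharZero K] {n : ℕ}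
    {V : Set (AlgTorus K n)} (hV : IsClosed V) :
    IsCosetUnion {x : CommGroup.torsion (AlgTorus K n) | (x : AlgTorus K n) ∈ V} := by
  obtain ⟨s, hs⟩ := (isNoetherianRing_iff_ideal_fg _).1 inferInstance (vanishingIdeal V)
  have hset : {x : CommGroup.torsion (AlgTorus K n) | (x : AlgTorus K n) ∈ V}
      = ⋂ f ∈ s, {x : CommGroup.torsion (AlgTorus K n) | evalAt (x : AlgTorus K n) f = 0} := by
    ext x
    rw [← zeroLocus_vanishingIdeal hV, ← hs, zeroLocus_span]
    simp only [Set.mem_iInter]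
    rfl
  rw [hset]
  refine IsCosetUnion.biInter s fun f _ => ?_
  have hΓ : IsMulTorsion (CommGroup.torsion (AlgTorus K n)) := CommMonoid.torsion.isMulTorsion
  have h := isCosetUnion_sum_eq_zero hΓ f.coeff.support f.coeff
    fun u => (character u).comp (CommGroup.torsion (AlgTorus K n)).subtype
  simp_rw [evalAt_eq_sum]
  exact h

end AlgTorus

open Pointwise in
theorem proposition5p2 {K : Type*} [Field K] [IsAlgClosed K] [CharZero K] (n : ℕ)
    (V : Set (AlgTorus K n)) (hV : IsClosed V) :
    ∃ 𝒯 : Set (Set (AlgTorus K n)), 𝒯.Finite ∧ (∀ T ∈ 𝒯, AlgTorus.IsTorsionCoset T) ∧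
      closure {x : AlgTorus K n | x ∈ V ∧ IsOfFinOrder x} = ⋃₀ 𝒯 := by
  obtain ⟨F, hF, hFV⟩ := AlgTorus.isCosetUnion_torsion_mem hV
  have hset : {x : AlgTorus K n | x ∈ V ∧ IsOfFinOrder x} = ⋃ p ∈ F, (p.1 : AlgTorus K n) •
      ((p.2.map (CommGroup.torsion (AlgTorus K n)).subtype : Subgroup (AlgTorus K n)) :
        Set (AlgTorus K n)) := by
    have himage : {x : AlgTorus K n | x ∈ V ∧ IsOfFinOrder x} = (CommGroup.torsion _).subtype ''
        {x : CommGroup.torsion (AlgTorus K n) | (x : AlgTorus K n) ∈ V} := by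
      ext x
      exact ⟨fun h => ⟨⟨x, h.2⟩, h.1, rfl⟩, by rintro ⟨y, hy, rfl⟩; exact ⟨hy, y.2⟩⟩
    rw [himage, hFV, Set.image_iUnion₂]
    refine Set.iUnion₂_congr fun p _ => ?_
    exact Set.image_smul_comm _ _ _ fun b => rfl
  choose 𝒯 hfin hcos hcl using fun p : CommGroup.torsion (AlgTorus K n) × Subgroup _ =>
    AlgTorus.closure_smul_subgroup_eq_sUnion
      (p.2.map (CommGroup.torsion (AlgTorus K n)).subtype) p.1.2
  refine ⟨⋃ p ∈ F, 𝒯 p, hF.biUnion fun p _ => hfin p, fun T hT => ?_, ?_⟩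
  · obtain ⟨p, -, hT⟩ := Set.mem_iUnion₂.1 hT
    exact hcos p T hT
  · rw [hset, hF.closure_biUnion]
    simp_rw [hcl, Set.sUnion_iUnion]
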